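/- **Setting.** Let $f:\mathbb R^n\to\mathbb R$ be convex and differentiable with $\|\nabla f(x)-\nabla f(x')\|_2\le L\|x-x'\|_2$ for all $x,x'$, where $L>0$, and let $0<\beta<2/L$. $\Gamma_0(\mathbb R^d)$ denotes the proper lower semicontinuous convex functions $\mathbb R^d\to\mathbb R\cup\{\infty\}$. For $\psi\in\Gamma_0(\mathbb R^d)$, let $\mathrm{prox}_\psi(x)=\operatorname{argmin}_u\{\tfrac12\|u-x\|_2^2+\psi(u)\}$ and $\psi^*(z)=\sup_y\{\langle z,y\rangle-\psi(y)\}$. An operator $T$ is *generalized averaged nonexpansive (GAN) with exponent $\gamma>0$* with respect to a norm $\|\cdot\|$ if there is $\mu>0$ with $$\|Tx-Ty\|^\gamma+\mu\|(x-Tx)-(y-Ty)\|^\gamma\le\|x-y\|^\gamma\quad\text{for all }x,y.$$ **Gradient descent.** $T_1:=\mathcal I-\beta\nabla f$ is GAN with exponent $2$ with respect to $\|\cdot\|_2$. If $f$ has a minimizer, then for every $x^0\in\mathbb R^n$ the sequence $x^{k+1}=x^k-\beta\nabla f(x^k)$ converges to a minimizer of $f$, and $\|x^{k+1}-x^k\|_2=o(k^{-1/2})$.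 **Proximal gradient.** Let $g\in\Gamma_0(\mathbb R^n)$. Then $T_2:=\mathrm{prox}_{\beta g}\circ(\mathcal I-\beta\nabla f)$ is GAN with exponent $2$ with respect to $\|\cdot\|_2$. If $f+g$ has a minimizer, then for every $x^0\in\mathbb R^n$ the sequence $x^{k+1}=\mathrm{prox}_{\beta g}(x^k-\beta\nabla f(x^k))$ converges to a minimizer of $f+g$, and $\|x^{k+1}-x^k\|_2=o(k^{-1/2})$. **Primal–dual fixed-point proximity algorithm.** Let $g\in\Gamma_0(\mathbb R^m)$, $h\in\Gamma_0(\mathbb R^n)$, $B\in\mathbb R^{m\times n}$, and $$0<\eta<\frac{2(2-\beta L)}{4\beta\|B\|_2^2+L(2-\beta L)},$$ where $\|B\|_2$ is the spectral norm. Define $$E=\begin{pmatrix}I_n&-\beta B^\top\\ \eta B&I_m\end{pmatrix},\quad G=\begin{pmatrix}I_n&-\beta B^\top\\-\eta B&I_m\end{pmatrix},\quad W=\begin{pmatrix}\tfrac1\beta I_n&-B^\top\\-B&\tfrac1\eta I_m\end{pmatrix}.$$ For $(x,y)\in\mathbb R^n\times\mathbb R^m$ put $r(x,y)=f(x)$ and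 $\widetilde T(x,y)=(\mathrm{prox}_{\beta h}(x),\mathrm{prox}_{\eta g^*}(y))$. Let $T_G$ map $u$ to the unique $v$ with $v=\widetilde T((E-G)v+Gu)$, and let $T_3:=T_G\circ(\mathcal I-W^{-1}\nabla r)$. Then $W$ is positive definite, and $T_3$ is GAN with exponent $2$ with respect to $\|v\|_W=(v^\top Wv)^{1/2}$. If $T_3$ has a fixed point, then for all $x^0\in\mathbb R^n$, $y^0\in\mathbb R^m$, the sequence $\{x^k\}$ generated by $$x^{k+1}=\mathrm{prox}_{\beta h}\bigl(x^k-\beta(\nabla f(x^k)+B^\top y^k)\bigr),\qquad y^{k+1}=\eta\bigl(\mathcal I-\mathrm{prox}_{\frac1\eta g}\bigr)\bigl(\tfrac1\eta y^k+B(2x^{k+1}-x^k)\bigr)$$ converges to a minimizer of $f+g\circ B+h$, and $\|x^{k+1}-x^k\|_2=o(k^{-1/2})$. -/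

import Mathlib

open Filter Topology Asymptotics
open scoped Matrix Matrix.Norms.L2Operator

noncomputable section

namespace FixedPointOpt

/-- Euclidean space of dimension `n`. -/
abbrev Vec (n : ℕ) : Type := EuclideanSpace ℝ (Fin n)

/-- The stacked space of pairs of a primal vector and a dual vector, with the Euclidean norm. -/
abbrev Stack (n m : ℕ) : Type := EuclideanSpace ℝ (Fin n ⊕ Fin m)

/-- Proper, lower semicontinuous, convex functions with values in `ℝ ∪ {∞}`. -/
structure IsGammaZero {n : ℕ} (φ : Vec n → EReal) : Prop where
  ne_bot : ∀ x, φ x ≠ ⊥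
  exists_ne_top : ∃ x, φ x ≠ ⊤
  lsc : LowerSemicontinuous φ
  convex : ∀ x y : Vec n, ∀ a b : ℝ, 0 < a → 0 < b → a + b = 1 →
    φ (a • x + b • y) ≤ (a : EReal) * φ x + (b : EReal) * φ y

/-- A (global) minimizer of an extended-valued function: a point of its domain at which the
function attains its smallest value. -/
def IsMinimizer {n : ℕ} (Ψ : Vec n → EReal) (x : Vec n) : Prop :=
  Ψ x ≠ ⊤ ∧ ∀ z, Ψ x ≤ Ψ z

/-- The point `p` minimizes `u ↦ ‖u - x‖² / 2 + φ u`. -/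
def IsProx {n : ℕ} (φ : Vec n → EReal) (x p : Vec n) : Prop :=
  IsMinimizer (fun u => ((1 / 2 * ‖u - x‖ ^ 2 : ℝ) : EReal) + φ u) p

/-- The proximity operator: the minimizer of `u ↦ ‖u - x‖² / 2 + φ u`
(it exists and is unique for proper lower semicontinuous convex `φ`). -/
def prox {n : ℕ} (φ : Vec n → EReal) (x : Vec n) : Vec n :=
  Classical.epsilon (IsProx φ x)

/-- The function `c φ`. -/
def scale {n : ℕ} (c : ℝ) (φ : Vec n → EReal) : Vec n → EReal :=
  fun x => (c : EReal) * φ x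

/-- The convex conjugate. -/
def conjugate {m : ℕ} (g : Vec m → EReal) : Vec m → EReal :=
  fun z => ⨆ y : Vec m, ((inner ℝ z y : ℝ) : EReal) - g y

/-- `T` is generalized averaged nonexpansive with exponent `γ` with respect to the
norm `nrm`. -/
def IsGAN {V : Type*} [AddCommGroup V] (nrm : V → ℝ) (γ : ℝ) (T : V → V) : Prop :=
  ∃ μ : ℝ, 0 < μ ∧ ∀ x y : V,
    nrm (T x - T y) ^ γ + μ * nrm ((x - T x) - (y - T y)) ^ γ ≤ nrm (x - y) ^ γ

/-- The weighted norm `(vᵀ W v)^(1/2)`. -/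
def weightedNorm {n m : ℕ} (W : Matrix (Fin n ⊕ Fin m) (Fin n ⊕ Fin m) ℝ)
    (v : Stack n m) : ℝ :=
  Real.sqrt (v.ofLp ⬝ᵥ (W *ᵥ v.ofLp))

/-- The product of a matrix and a Euclidean vector. -/
def app {ι κ : Type*} [Fintype κ] (M : Matrix ι κ ℝ)
    (v : EuclideanSpace ℝ κ) : EuclideanSpace ℝ ι :=
  WithLp.toLp 2 (M *ᵥ v.ofLp)

/-- The primal block of a stacked vector. -/
def primal {n m : ℕ} (v : Stack n m) : Vec n := WithLp.toLp 2 fun i => v (Sum.inl i)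

/-- The dual block of a stacked vector. -/
def dual {n m : ℕ} (v : Stack n m) : Vec m := WithLp.toLp 2 fun j => v (Sum.inr j)

/-- The stacked vector with the given blocks. -/
def stack {n m : ℕ} (x : Vec n) (y : Vec m) : Stack n m :=
  WithLp.toLp 2 (Sum.elim x.ofLp y.ofLp)

/-- The gradient descent operator `I - β ∇f`. -/
def T₁ {n : ℕ} (f : Vec n → ℝ) (β : ℝ) (x : Vec n) : Vec n :=
  x - β • gradient f x

/-- The proximal gradient operator `prox_{βg} ∘ (I - β ∇f)`. -/
def T₂ {n : ℕ} (f : Vec n → ℝ) (g : Vec n → EReal) (β : ℝ) (x : Vec n) : Vec n :=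
  prox (scale β g) (T₁ f β x)

/-- The block matrix `E`. -/
def matE {n m : ℕ} (B : Matrix (Fin m) (Fin n) ℝ) (β η : ℝ) :
    Matrix (Fin n ⊕ Fin m) (Fin n ⊕ Fin m) ℝ :=
  Matrix.fromBlocks 1 (-(β • Bᵀ)) (η • B) 1

/-- The block matrix `G`. -/
def matG {n m : ℕ} (B : Matrix (Fin m) (Fin n) ℝ) (β η : ℝ) :
    Matrix (Fin n ⊕ Fin m) (Fin n ⊕ Fin m) ℝ :=
  Matrix.fromBlocks 1 (-(β • Bᵀ)) (-(η • B)) 1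

/-- The weight matrix `W`. -/
def matW {n m : ℕ} (B : Matrix (Fin m) (Fin n) ℝ) (β η : ℝ) :
    Matrix (Fin n ⊕ Fin m) (Fin n ⊕ Fin m) ℝ :=
  Matrix.fromBlocks ((1 / β) • 1) (-Bᵀ) (-B) ((1 / η) • 1)

/-- The blockwise proximity operator `(x, y) ↦ (prox_{βh} x, prox_{ηg*} y)`. -/
def blockProx {n m : ℕ} (g : Vec m → EReal) (h : Vec n → EReal) (β η : ℝ)
    (v : Stack n m) : Stack n m :=
  stack (prox (scale β h) (primal v)) (prox (scale η (conjugate g)) (dual v))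

/-- The implicit relation between `u` and `v` that defines the operator `T_G`. -/
def RelTG {n m : ℕ} (g : Vec m → EReal) (h : Vec n → EReal)
    (B : Matrix (Fin m) (Fin n) ℝ) (β η : ℝ) (u v : Stack n m) : Prop :=
  v = blockProx g h β η (app (matE B β η - matG B β η) v + app (matG B β η) u)

lemma matE_sub_matG {n m : ℕ} (B : Matrix (Fin m) (Fin n) ℝ) (β η : ℝ) :
    matE B β η - matG B β η = Matrix.fromBlocks 0 0 ((2 * η) • B) 0 := by
  ext i j
  rcases i with i | i <;> rcases j with j | j <;> simp [matE, matG]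
  ring

lemma primal_app_sub {n m : ℕ} (B : Matrix (Fin m) (Fin n) ℝ) (β η : ℝ) (v w : Stack n m) :
    primal (app (matE B β η - matG B β η) v + w) = primal w := by
  ext i
  simp [primal, app, matE_sub_matG, Matrix.mulVec, dotProduct]

lemma dual_app_sub {n m : ℕ} (B : Matrix (Fin m) (Fin n) ℝ) (β η : ℝ) (v w : Stack n m) :
    dual (app (matE B β η - matG B β η) v + w) = app ((2 * η) • B) (primal v) + dual w := by
  ext i
  simp [primal, dual, app, matE_sub_matG, Matrix.mulVec, dotProduct]

/-- The relation defining `T_G` is the graph of a map. -/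
theorem existsUnique_relTG {n m : ℕ} (g : Vec m → EReal) (h : Vec n → EReal)
    (B : Matrix (Fin m) (Fin n) ℝ) (β η : ℝ) (u : Stack n m) :
    ∃! v, RelTG g h B β η u v := by
  refine ⟨stack (prox (scale β h) (primal (app (matG B β η) u)))
    (prox (scale η (conjugate g)) (app ((2 * η) • B)
      (prox (scale β h) (primal (app (matG B β η) u))) + dual (app (matG B β η) u))), ?_, ?_⟩
  · simp only [RelTG, blockProx, primal_app_sub, dual_app_sub]
    rfl
  · intro v hv
    simp only [RelTG, blockProx, primal_app_sub, dual_app_sub] at hv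
    have hp : primal v = prox (scale β h) (primal (app (matG B β η) u)) := by
      rw [hv]; rfl
    rw [hp] at hv
    exact hv

/-- The operator `T_G`: it maps `u` to the unique `v` with
`v = T̃ ((E - G) v + G u)`, where `T̃` is the blockwise proximity operator. -/
def TG {n m : ℕ} (g : Vec m → EReal) (h : Vec n → EReal)
    (B : Matrix (Fin m) (Fin n) ℝ) (β η : ℝ) (u : Stack n m) : Stack n m :=
  (existsUnique_relTG g h B β η u).choose

/-- The primal-dual operator `T_G ∘ (I - W⁻¹ ∇r)`, where `r (x, y) = f x`. -/
def T₃ {n m : ℕ} (f : Vec n → ℝ) (g : Vec m → EReal) (h : Vec n → EReal)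
    (B : Matrix (Fin m) (Fin n) ℝ) (β η : ℝ) (v : Stack n m) : Stack n m :=
  TG g h B β η (v - app (matW B β η)⁻¹ (gradient (fun w : Stack n m => f (primal w)) v))

/-- `x` converges to a minimizer of `Ψ` and `‖x (k + 1) - x k‖ = o(k^(-1/2))`. -/
def ConvergesWithRate {n : ℕ} (Ψ : Vec n → EReal) (x : ℕ → Vec n) : Prop :=
  (∃ xstar, IsMinimizer Ψ xstar ∧ Tendsto x atTop (𝓝 xstar)) ∧
    (fun k => ‖x (k + 1) - x k‖) =o[atTop] fun k : ℕ => (k : ℝ) ^ (-(1 / 2) : ℝ)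

end FixedPointOpt

end

open FixedPointOpt

/-! All three operators are forward-backward operators: a gradient step followed by an implicit step
along a monotone subdifferential. For two inputs let `d` be their difference, `e` that of the
outputs and `r = d - e`. Expanding the square of `d = r + e` in the relevant metric gives `D = E + R
+ 2 * S`. Monotonicity of subgradients gives `⟪Δ∇f, e⟫ ≤ S`, and cocoercivity of the gradient
(Baillon–Haddad, `ConvexOn.norm_gradient_sub_sq_le`) bounds what is lost; `add_mul_le_of_cocoercive`
concludes as soon as `R ≥ c * ‖r‖ ^ 2` with `c > L / 2`. For proximal gradient `c = β⁻¹`; gradient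
descent is the case `g = 0`. For the primal-dual method the metric is `W`, only the primal block of
`r` matters, and `c = β⁻¹ - η * ‖B‖ ^ 2`.

The GAN inequality makes distances to fixed points decrease and squared residuals summable, so a
compactness argument gives convergence, and monotonicity of the residuals gives the rate
(`IsGAN.tendsto_fixedPoint`). Fixed points yield minimizers through subgradient calculus; Moreau's
decomposition removes the conjugate from the dual step. -/

namespace FixedPointOpt

/-! ### Convex functions with Lipschitz gradient. -/

section Smooth

lemma le_of_hasDerivAt_of_forall_le {φ : ℝ → ℝ} {c d : ℝ} (hφ : HasDerivAt φ d 0)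
    (h : ∀ t, 0 < t → t < 1 → φ 0 + t * c ≤ φ t) : c ≤ d := by
  have h1 : Tendsto (fun t : ℝ => t⁻¹ • (φ (0 + t) - φ 0)) (𝓝[>] 0) (𝓝 d) :=
    hφ.tendsto_slope_zero_right
  refine ge_of_tendsto h1 ?_
  filter_upwards [Ioo_mem_nhdsGT (zero_lt_one' ℝ)] with t ht
  have := h t ht.1 ht.2
  rw [zero_add, smul_eq_mul, ← div_eq_inv_mul, le_div_iff₀ ht.1]
  linarith

variable {E : Type*} [NormedAddCommGroup E] [InnerProductSpace ℝ E] [CompleteSpace E]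

lemma HasGradientAt.hasDerivAt_line {f : E → ℝ} {G x v : E} {t : ℝ}
    (h : HasGradientAt f G (x + t • v)) :
    HasDerivAt (fun s : ℝ => f (x + s • v)) (inner ℝ G v) t := by
  have h1 : HasDerivAt (fun s : ℝ => x + s • v) v t := by
    simpa using ((hasDerivAt_id t).smul_const v).const_add x
  simpa [Function.comp_def] using h.hasFDerivAt.comp_hasDerivAt (f := fun s : ℝ => x + s • v) t h1

lemma _root_.ConvexOn.add_inner_gradient_le {f : E → ℝ} (hf : ConvexOn ℝ Set.univ f)
    (hd : Differentiable ℝ f) (x z : E) : f x + inner ℝ (gradient f x) (z - x) ≤ f z := by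
  have h0 : HasGradientAt f (gradient f x) (x + (0 : ℝ) • (z - x)) := by
    simpa using (hd x).hasGradientAt
  have h1 := (HasGradientAt.hasDerivAt_line h0).fun_neg
  have := le_of_hasDerivAt_of_forall_le (c := f x - f z) h1 fun t ht0 ht1 => by
    have := hf.2 (Set.mem_univ x) (Set.mem_univ z) (sub_nonneg.2 ht1.le) ht0.le (by ring)
    have e : (1 - t) • x + t • z = x + t • (z - x) := by module
    rw [e] at this
    simp only [zero_smul, add_zero, smul_eq_mul] at this ⊢
    linarith
  linarith

lemma le_add_inner_gradient_add_sq {f : E → ℝ} {L : ℝ} (hd : Differentiable ℝ f)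
    (hlip : ∀ x y, ‖gradient f x - gradient f y‖ ≤ L * ‖x - y‖) (x z : E) :
    f z ≤ f x + inner ℝ (gradient f x) (z - x) + L / 2 * ‖z - x‖ ^ 2 := by
  set v := z - x with hv
  let ψ : ℝ → ℝ := fun t =>
    f (x + t • v) - (t * inner ℝ (gradient f x) v + L / 2 * ‖v‖ ^ 2 * t ^ 2)
  have hψ : ∀ t, HasDerivAt ψ (inner ℝ (gradient f (x + t • v)) v -
      (1 * inner ℝ (gradient f x) v + L / 2 * ‖v‖ ^ 2 * (2 * t))) t := fun t => by
    refine (HasGradientAt.hasDerivAt_line (hd _).hasGradientAt).sub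
      (((hasDerivAt_id t).mul_const _).add ?_)
    simpa using (hasDerivAt_pow 2 t).const_mul (L / 2 * ‖v‖ ^ 2)
  have hanti : AntitoneOn ψ (Set.Icc 0 1) := by
    refine antitoneOn_of_deriv_nonpos (convex_Icc 0 1)
      (fun t _ => (hψ t).continuousAt.continuousWithinAt)
      (fun t _ => (hψ t).differentiableAt.differentiableWithinAt) fun t ht => ?_
    rw [interior_Icc] at ht
    rw [(hψ t).deriv]
    have h1 : inner ℝ (gradient f (x + t • v) - gradient f x) v ≤ L * t * ‖v‖ ^ 2 := by
      refine (real_inner_le_norm _ _).trans ?_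
      have := hlip (x + t • v) x
      rw [add_sub_cancel_left, norm_smul, Real.norm_of_nonneg ht.1.le] at this
      nlinarith [norm_nonneg v]
    rw [inner_sub_left] at h1
    linarith
  have := hanti (Set.left_mem_Icc.2 zero_le_one) (Set.right_mem_Icc.2 zero_le_one) zero_le_one
  simp only [ψ, one_smul, zero_smul, add_zero, hv, add_sub_cancel] at this
  rw [← hv] at this
  linarith

/-- Baillon–Haddad: the tangent at `x` lies below `f`, which lies below the quadratic upper bound at
`y`; `key` evaluates both at one point, and adding its two symmetric versions gives cocoercivity. -/
lemma _root_.ConvexOn.norm_gradient_sub_sq_le {f : E → ℝ} {L : ℝ} (hf : ConvexOn ℝ Set.univ f)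
    (hd : Differentiable ℝ f) (hL : 0 < L)
    (hlip : ∀ x y, ‖gradient f x - gradient f y‖ ≤ L * ‖x - y‖) (x y : E) :
    ‖gradient f x - gradient f y‖ ^ 2 ≤ L * inner ℝ (gradient f x - gradient f y) (x - y) := by
  have key : ∀ x y : E, ‖gradient f x - gradient f y‖ ^ 2 ≤
      2 * L * (f y - f x - inner ℝ (gradient f x) (y - x)) := fun x y => by
    set d := gradient f x - gradient f y with hd'
    -- The point `y + L⁻¹ • d` minimizes the quadratic bound at `y` minus the tangent at `x`.
    have h1 := hf.add_inner_gradient_le hd x (y + L⁻¹ • d)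
    have h2 := le_add_inner_gradient_add_sq hd hlip y (y + L⁻¹ • d)
    have e1 : y + L⁻¹ • d - x = (y - x) + L⁻¹ • d := by abel
    have e2 : inner ℝ (gradient f x) d - inner ℝ (gradient f y) d = ‖d‖ ^ 2 := by
      rw [← inner_sub_left, ← hd', real_inner_self_eq_norm_sq]
    rw [add_sub_cancel_left, norm_smul, inner_smul_right, mul_pow, Real.norm_eq_abs, sq_abs] at h2
    rw [e1, inner_add_right, inner_smul_right] at h1
    have e3 : L / 2 * (L⁻¹ ^ 2 * ‖d‖ ^ 2) = L⁻¹ / 2 * ‖d‖ ^ 2 := by field_simp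
    have h3 : L⁻¹ / 2 * ‖d‖ ^ 2 ≤ f y - f x - inner ℝ (gradient f x) (y - x) := by
      rw [e3] at h2
      have : L⁻¹ * ‖d‖ ^ 2 = L⁻¹ * inner ℝ (gradient f x) d - L⁻¹ * inner ℝ (gradient f y) d := by
        rw [← e2]; ring
      linarith
    calc ‖d‖ ^ 2 = 2 * L * (L⁻¹ / 2 * ‖d‖ ^ 2) := by field_simp
      _ ≤ _ := by gcongr
  have h1 := key x y
  have h2 := key y x
  rw [norm_sub_rev] at h2
  have e : inner ℝ (gradient f x - gradient f y) (x - y) =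
      -inner ℝ (gradient f x) (y - x) - inner ℝ (gradient f y) (x - y) := by
    simp only [inner_sub_left, ← neg_sub y x, inner_neg_right]
    ring
  rw [e]
  linarith

end Smooth

/-! ### Convergence and rate for averaged iterations. -/

section Iteration

lemma isLittleO_of_antitone_of_summable_sq {a : ℕ → ℝ} (ha : ∀ k, 0 ≤ a k) (hanti : Antitone a)
    (hs : Summable fun k => a k ^ 2) : a =o[atTop] fun k : ℕ => (k : ℝ) ^ (-(1 / 2) : ℝ) := by
  have hlim : Tendsto (fun k : ℕ => (k : ℝ) * a k ^ 2) atTop (𝓝 0) := by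
    have htail := tendsto_sum_nat_add fun k => a k ^ 2
    -- At least half of the indices up to `k` lie in `[k / 2, k)`, and there the terms are at least
    -- `a k ^ 2`; so `k * a k ^ 2` is at most twice a tail of the series.
    have h2 : Tendsto (fun k : ℕ => 2 * ∑' i, a (i + k / 2) ^ 2) atTop (𝓝 0) := by
      simpa using (htail.comp (Nat.tendsto_div_const_atTop two_ne_zero)).const_mul 2
    refine squeeze_zero (fun k => by positivity) (fun k => ?_) h2
    have h3 : ∑ i ∈ Finset.range (k - k / 2), a (i + k / 2) ^ 2 ≤ ∑' i, a (i + k / 2) ^ 2 :=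
      Summable.sum_le_tsum _ (fun _ _ => sq_nonneg _) ((summable_nat_add_iff (k / 2)).2 hs)
    have h4 : ∑ _i ∈ Finset.range (k - k / 2), a k ^ 2 ≤
        ∑ i ∈ Finset.range (k - k / 2), a (i + k / 2) ^ 2 := by
      refine Finset.sum_le_sum fun i hi => ?_
      have := Finset.mem_range.1 hi
      exact pow_le_pow_left₀ (ha k) (hanti (by omega)) 2
    rw [Finset.sum_const, Finset.card_range, nsmul_eq_mul] at h4
    have h5 : (k : ℝ) ≤ 2 * ((k - k / 2 : ℕ) : ℝ) := by
      exact_mod_cast (by omega : k ≤ 2 * (k - k / 2))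
    nlinarith [sq_nonneg (a k)]
  rw [isLittleO_iff]
  intro c hc
  have hc2 : 0 < c ^ 2 := by positivity
  filter_upwards [hlim.eventually (gt_mem_nhds hc2), eventually_gt_atTop 0] with k hk hk0
  have hk0' : (0 : ℝ) < k := by exact_mod_cast hk0
  rw [Real.norm_of_nonneg (ha k), Real.norm_of_nonneg (by positivity)]
  refine (sq_le_sq₀ (ha k) (by positivity)).1 ?_
  have e : ((k : ℝ) ^ (-(1 / 2) : ℝ)) ^ 2 = (k : ℝ)⁻¹ := by
    rw [← Real.rpow_natCast, ← Real.rpow_mul hk0'.le]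
    norm_num [Real.rpow_neg_one]
  rw [mul_pow, e, ← div_eq_mul_inv, le_div_iff₀ hk0']
  linarith

/-- Iterates of a generalized averaged nonexpansive operator, with respect to a gauge equivalent to
the norm, converge to a fixed point, with a rate for the residuals. -/
theorem IsGAN.tendsto_fixedPoint {V : Type*} [NormedAddCommGroup V] [NormedSpace ℝ V]
    [ProperSpace V] {N : V → ℝ} {T : V → V} {c C : ℝ} (hc : 0 < c)
    (hlow : ∀ v, c * ‖v‖ ≤ N v) (hup : ∀ v, N v ≤ C * ‖v‖)
    (hT : IsGAN N 2 T) {z : ℕ → V} (hz : ∀ k, z (k + 1) = T (z k))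
    (hfix : (Function.fixedPoints T).Nonempty) :
    (∃ q, T q = q ∧ Tendsto z atTop (𝓝 q)) ∧
      (fun k => ‖z (k + 1) - z k‖) =o[atTop] fun k : ℕ => (k : ℝ) ^ (-(1 / 2) : ℝ) := by
  obtain ⟨μ, hμ, hT⟩ := hT
  simp only [Real.rpow_two] at hT
  have hN : ∀ v, 0 ≤ N v := fun v => (by positivity : 0 ≤ c * ‖v‖).trans (hlow v)
  have hN0 : N 0 = 0 := le_antisymm (by simpa using hup 0) (hN 0)
  have hne : ∀ x y, N (T x - T y) ≤ N (x - y) := fun x y =>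
    (sq_le_sq₀ (hN _) (hN _)).1 (by nlinarith [hT x y, sq_nonneg (N ((x - T x) - (y - T y)))])
  have hfp : ∀ q, T q = q → ∀ k, N (z (k + 1) - q) ^ 2 + μ * N (z k - z (k + 1)) ^ 2 ≤
      N (z k - q) ^ 2 := fun q hq k => by
    have := hT (z k) q
    rwa [hq, ← hz, sub_self, sub_zero] at this
  have hanti : ∀ q, T q = q → Antitone fun k => N (z k - q) := fun q hq =>
    antitone_nat_of_succ_le fun k => by
      have := hne (z k) q
      rwa [hq, ← hz] at this
  obtain ⟨p, hp⟩ := hfix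
  have hp : T p = p := hp
  have hsum : Summable fun k => N (z k - z (k + 1)) ^ 2 := by
    refine summable_of_sum_range_le (c := N (z 0 - p) ^ 2 / μ) (fun _ => sq_nonneg _) fun k => ?_
    rw [le_div_iff₀ hμ]
    have : ∀ k, (∑ i ∈ Finset.range k, N (z i - z (i + 1)) ^ 2) * μ + N (z k - p) ^ 2 ≤
        N (z 0 - p) ^ 2 := fun k => by
      induction k with
      | zero => simp
      | succ k ih => rw [Finset.sum_range_succ]; linarith [hfp p hp k]
    linarith [this k, sq_nonneg (N (z k - p))]
  -- `N` need not satisfy the triangle inequality, so continuity comes from the two-sided comparison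
  -- with the norm.
  have hcontT : Continuous T := by
    have hC : 0 ≤ |C| / c := by positivity
    refine LipschitzWith.continuous (K := ⟨|C| / c, hC⟩) (LipschitzWith.of_dist_le_mul fun x y => ?_)
    rw [dist_eq_norm, dist_eq_norm]
    change _ ≤ |C| / c * _
    rw [div_mul_eq_mul_div, le_div_iff₀ hc, mul_comm]
    exact (hlow _).trans ((hne x y).trans ((hup _).trans
      (mul_le_mul_of_nonneg_right (le_abs_self C) (norm_nonneg _))))
  have hto : ∀ w : ℕ → V, Tendsto (fun k => N (w k)) atTop (𝓝 0) → Tendsto w atTop (𝓝 0) := by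
    intro w hw
    refine squeeze_zero_norm (a := fun k => N (w k) / c) (fun k => ?_) (by simpa using hw.div_const c)
    rw [le_div_iff₀ hc, mul_comm]
    exact hlow _
  have hres0 : Tendsto (fun k => z k - T (z k)) atTop (𝓝 0) := by
    refine hto _ ?_
    have := hsum.tendsto_atTop_zero.sqrt
    simpa only [Real.sqrt_sq (hN _), hz, Real.sqrt_zero] using this
  have hbdd : ∀ k, z k ∈ Metric.closedBall p (N (z 0 - p) / c) := fun k => by
    rw [Metric.mem_closedBall, dist_eq_norm, le_div_iff₀ hc, mul_comm]
    exact (hlow _).trans (hanti p hp (Nat.zero_le k))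
  obtain ⟨q, -, φ, hφ, hq⟩ := (isCompact_closedBall p _).tendsto_subseq hbdd
  have hTq : T q = q := by
    have h1 := hres0.comp hφ.tendsto_atTop
    have h2 := hq.sub ((hcontT.tendsto q).comp hq)
    exact (sub_eq_zero.1 (tendsto_nhds_unique h2 h1)).symm
  refine ⟨⟨q, hTq, ?_⟩, ?_⟩
  · have hsub : Tendsto (fun k => N (z (φ k) - q)) atTop (𝓝 0) := by
      refine squeeze_zero (fun _ => hN _) (fun k => hup _) ?_
      have : Tendsto (fun k => z (φ k) - q) atTop (𝓝 0) := by
        simpa using hq.sub_const q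
      simpa using this.norm.const_mul C
    -- The cluster point `q` is itself fixed, so the distance to it decreases along the whole
    -- sequence and a null subsequence suffices.
    have hall : Tendsto (fun k => N (z k - q)) atTop (𝓝 0) :=
      (tendsto_iff_tendsto_subseq_of_antitone (hanti q hTq) hφ.tendsto_atTop).2 hsub
    simpa using (hto _ hall).add_const q
  · have hanti' : Antitone fun k => N (z k - z (k + 1)) :=
      antitone_nat_of_succ_le fun k => by
        rw [hz (k + 1)]
        nth_rw 1 [hz k]
        exact hne _ _
    refine IsBigO.trans_isLittleO ?_ (isLittleO_of_antitone_of_summable_sq (fun _ => hN _) hanti' hsum)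
    refine IsBigO.of_bound c⁻¹ (Eventually.of_forall fun k => ?_)
    rw [norm_norm, Real.norm_of_nonneg (hN _), norm_sub_rev, ← div_eq_inv_mul, le_div_iff₀ hc,
      mul_comm]
    exact hlow _

end Iteration

/-! ### Subgradients of extended-valued functions. -/

section Subgradient

variable {n : ℕ} {φ : Vec n → EReal}

/-- `s` is a subgradient of `φ` at the point `p` of its domain. -/
def IsSubgrad (φ : Vec n → EReal) (p s : Vec n) : Prop :=
  ∃ r : ℝ, φ p = r ∧ ∀ u, ((r + inner ℝ s (u - p) : ℝ) : EReal) ≤ φ u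

lemma IsSubgrad.inner_nonneg {p q s t : Vec n} (hp : IsSubgrad φ p s) (hq : IsSubgrad φ q t) :
    0 ≤ inner ℝ (s - t) (p - q) := by
  obtain ⟨a, ha, hp⟩ := hp
  obtain ⟨b, hb, hq⟩ := hq
  have h1 := hp q
  have h2 := hq p
  rw [hb, EReal.coe_le_coe_iff] at h1
  rw [ha, EReal.coe_le_coe_iff] at h2
  rw [inner_sub_left]
  rw [← neg_sub p q, inner_neg_right] at h1
  linarith

lemma isSubgrad_scale_iff {c : ℝ} (hc : 0 < c) {p s : Vec n} :
    IsSubgrad (scale c φ) p (c • s) ↔ IsSubgrad φ p s := by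
  have hmul : ∀ {c : ℝ} (_ : 0 < c) (ψ : Vec n → EReal) (w : Vec n), IsSubgrad ψ p w →
      IsSubgrad (scale c ψ) p (c • w) := by
    rintro c hc ψ w ⟨r, hr, h⟩
    refine ⟨c * r, by simp [scale, hr], fun u => ?_⟩
    rw [inner_smul_left, RCLike.conj_to_real, ← mul_add, EReal.coe_mul]
    exact mul_le_mul_of_nonneg_left (h u) (EReal.coe_nonneg.2 hc.le)
  refine ⟨fun h => ?_, hmul hc φ s⟩
  have := hmul (inv_pos.2 hc) _ _ h
  rw [inv_smul_smul₀ hc.ne'] at this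
  convert this using 1
  funext u
  rw [scale, scale, ← mul_assoc, ← EReal.coe_mul, inv_mul_cancel₀ hc.ne', EReal.coe_one, one_mul]

lemma IsGammaZero.scale (hφ : IsGammaZero φ) {c : ℝ} (hc : 0 < c) : IsGammaZero (scale c φ) := by
  have hc0 : (0 : EReal) ≤ c := EReal.coe_nonneg.2 hc.le
  constructor
  · intro x
    simp only [FixedPointOpt.scale]
    induction h : φ x with
    | bot => exact absurd h (hφ.ne_bot x)
    | coe r => rw [← EReal.coe_mul]; exact EReal.coe_ne_bot _
    | top => rw [EReal.coe_mul_top_of_pos hc]; simp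
  · obtain ⟨x, hx⟩ := hφ.exists_ne_top
    refine ⟨x, ?_⟩
    lift φ x to ℝ using ⟨hx, hφ.ne_bot x⟩ with r hr
    rw [FixedPointOpt.scale, ← hr, ← EReal.coe_mul]
    exact EReal.coe_ne_top _
  · have hcont : Continuous fun y : EReal => (c : EReal) * y :=
      continuous_iff_continuousAt.2 fun y => by
        have : ContinuousAt (fun p : EReal × EReal => p.1 * p.2) (↑c, y) :=
          EReal.continuousAt_mul (by simp [hc.ne']) (by simp [hc.ne']) (by simp) (by simp)
        exact this.comp (f := fun y : EReal => ((c : EReal), y)) (by fun_prop)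
    exact hcont.comp_lowerSemicontinuous hφ.lsc fun a b h => mul_le_mul_of_nonneg_left h hc0
  · intro x y a b ha hb hab
    have h := mul_le_mul_of_nonneg_left (hφ.convex x y a b ha hb hab) hc0
    refine h.trans_eq ?_
    simp only [FixedPointOpt.scale]
    rw [EReal.left_distrib_of_nonneg_of_ne_top hc0 (EReal.coe_ne_top c),
      mul_left_comm (c : EReal), mul_left_comm (c : EReal)]

lemma isGammaZero_zero : IsGammaZero (fun _ : Vec n => (0 : EReal)) where
  ne_bot := by simp
  exists_ne_top := ⟨0, by simp⟩
  lsc := lowerSemicontinuous_const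
  convex := by simp

/-- Fermat's rule for the sum of a differentiable and a convex function. -/
lemma IsMinimizer.isSubgrad (hφ : IsGammaZero φ) {F : Vec n → ℝ} {G p : Vec n}
    (hF : HasGradientAt F G p) (hmin : IsMinimizer (fun u => (F u : EReal) + φ u) p) :
    IsSubgrad φ p (-G) := by
  have hp : φ p ≠ ⊤ := fun h => hmin.1 (by simp [h])
  lift φ p to ℝ using ⟨hp, hφ.ne_bot p⟩ with r hr
  refine ⟨r, hr.symm, fun u => ?_⟩
  induction hu : φ u with
  | bot => exact absurd hu (hφ.ne_bot u)
  | top => exact le_top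
  | coe s =>
    rw [EReal.coe_le_coe_iff]
    have h0 : HasGradientAt F G (p + (0 : ℝ) • (u - p)) := by simpa using hF
    -- On the segment from `p` to `u`, convexity bounds `φ` by the chord from `r` to `s`, so
    -- minimality makes `F` grow at rate at least `r - s`.
    have := le_of_hasDerivAt_of_forall_le (c := r - s) (HasGradientAt.hasDerivAt_line h0)
      fun t ht0 ht1 => by
        have e : (1 - t) • p + t • u = p + t • (u - p) := by module
        have h1 := hφ.convex p u (1 - t) t (by linarith) ht0 (by ring)
        have h2 := hmin.2 (p + t • (u - p))
        rw [e, ← hr, hu] at h1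
        simp only [← hr] at h2
        have h3 := h2.trans (add_le_add_right h1 _)
        norm_cast at h3
        simp only [zero_smul, add_zero]
        linarith
    rw [inner_neg_left]
    linarith

/-- Only an affine minorant of `F` touching at `p` is needed; adding it to the subgradient
inequality cancels the linear terms. -/
lemma IsSubgrad.isMinimizer {F : Vec n → ℝ} {G p : Vec n}
    (hF : ∀ u, F p + inner ℝ G (u - p) ≤ F u) (h : IsSubgrad φ p (-G)) :
    IsMinimizer (fun u => (F u : EReal) + φ u) p := by
  obtain ⟨r, hr, h⟩ := h
  refine ⟨by simp only [hr, ← EReal.coe_add]; exact EReal.coe_ne_top _, fun u => ?_⟩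
  refine le_trans ?_ (add_le_add_right (h u) _)
  simp only [hr]
  rw [← EReal.coe_add, ← EReal.coe_add, EReal.coe_le_coe_iff, inner_neg_left]
  linarith [hF u]

end Subgradient

/-! ### Existence and characterization of proximal points; Moreau's decomposition. -/

section Prox

variable {n : ℕ} {φ : Vec n → EReal}

/-- Let `M` be the minimum of `φ` on the closed unit ball about `x₀`. For `u` farther away,
convexity on the segment to `u`, at its point on the unit sphere, gives the bound with `D = r₀ - M`.
This replaces a separation argument for coercivity. -/
lemma IsGammaZero.exists_linear_lower_bound (hφ : IsGammaZero φ) {x₀ : Vec n} {r₀ : ℝ}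
    (h₀ : φ x₀ = r₀) : ∃ D : ℝ, 0 ≤ D ∧ ∀ u, 1 ≤ ‖u - x₀‖ →
      ((r₀ - D * ‖u - x₀‖ : ℝ) : EReal) ≤ φ u := by
  obtain ⟨y, -, hy⟩ := LowerSemicontinuousOn.exists_isMinOn
    (Metric.nonempty_closedBall.2 zero_le_one) (isCompact_closedBall x₀ 1)
    (hφ.lsc.lowerSemicontinuousOn _)
  have hy0 : φ y ≤ r₀ := h₀ ▸ hy (Metric.mem_closedBall_self zero_le_one)
  obtain ⟨M, hM⟩ : ∃ M : ℝ, φ y = M :=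
    ⟨_, (EReal.coe_toReal (hy0.trans_lt (EReal.coe_lt_top _)).ne (hφ.ne_bot y)).symm⟩
  rw [hM, EReal.coe_le_coe_iff] at hy0
  refine ⟨r₀ - M, by linarith, fun u hu => ?_⟩
  induction hs : φ u with
  | bot => exact absurd hs (hφ.ne_bot u)
  | top => exact le_top
  | coe s =>
    rw [EReal.coe_le_coe_iff]
    set ρ := ‖u - x₀‖
    have hρ : 0 < ρ := by linarith
    rcases hu.eq_or_lt with hu | hu
    · have : φ y ≤ φ u := hy (by rw [Metric.mem_closedBall, dist_eq_norm]; exact hu.ge)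
      rw [hM, hs, EReal.coe_le_coe_iff] at this
      rw [← hu]
      linarith
    · have h1 := hφ.convex x₀ u (1 - ρ⁻¹) ρ⁻¹ (sub_pos.2 (inv_lt_one_of_one_lt₀ hu))
        (inv_pos.2 hρ) (by ring)
      have h2 : φ y ≤ φ ((1 - ρ⁻¹) • x₀ + ρ⁻¹ • u) := hy <| by
        have e : (1 - ρ⁻¹) • x₀ + ρ⁻¹ • u - x₀ = ρ⁻¹ • (u - x₀) := by module
        rw [Metric.mem_closedBall, dist_eq_norm, e, norm_smul, Real.norm_of_nonneg (by positivity),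
          inv_mul_cancel₀ hρ.ne']
      have h3 := h2.trans h1
      rw [hM, h₀, hs] at h3
      norm_cast at h3
      have h4 : ρ * M ≤ ρ * ((1 - ρ⁻¹) * r₀ + ρ⁻¹ * s) := by gcongr
      have h5 : ρ * ((1 - ρ⁻¹) * r₀ + ρ⁻¹ * s) = (ρ - 1) * r₀ + s := by field_simp
      linarith

lemma IsGammaZero.exists_isProx (hφ : IsGammaZero φ) (x : Vec n) : ∃ p, IsProx φ x p := by
  obtain ⟨x₀, hx₀⟩ := hφ.exists_ne_top
  obtain ⟨r₀, h₀⟩ : ∃ r : ℝ, φ x₀ = r := ⟨_, (EReal.coe_toReal hx₀ (hφ.ne_bot x₀)).symm⟩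
  obtain ⟨D, hD, hlow⟩ := hφ.exists_linear_lower_bound h₀
  set a := ‖x₀ - x‖ with ha
  have ha0 : 0 ≤ a := norm_nonneg _
  let Ψ : Vec n → EReal := fun u => ((1 / 2 * ‖u - x‖ ^ 2 : ℝ) : EReal) + φ u
  have hlsc : LowerSemicontinuous Ψ := by
    refine LowerSemicontinuous.add' (Continuous.lowerSemicontinuous ?_) hφ.lsc fun u => ?_
    · exact continuous_coe_real_ereal.comp (by fun_prop)
    · exact EReal.continuousAt_add (.inl (EReal.coe_ne_top _)) (.inl (EReal.coe_ne_bot _))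
  -- For `ρ = ‖u - x₀‖ ≥ 2 * (a + D)` one has `(ρ - a) ^ 2 / 2 - D * ρ ≥ a ^ 2 / 2`; the extra `1`
  -- puts `u` where the linear bound holds.
  have hR : 0 ≤ 2 * (a + D) + 1 := by linarith
  obtain ⟨p, -, hp⟩ := LowerSemicontinuousOn.exists_isMinOn
    (Metric.nonempty_closedBall.2 hR) (isCompact_closedBall x₀ _) (hlsc.lowerSemicontinuousOn _)
  have hp0 : Ψ p ≤ Ψ x₀ := hp (Metric.mem_closedBall_self hR)
  refine ⟨p, ne_top_of_le_ne_top ?_ hp0, fun u => ?_⟩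
  · simp only [Ψ, h₀, ← EReal.coe_add]
    exact EReal.coe_ne_top _
  by_cases hu : u ∈ Metric.closedBall x₀ (2 * (a + D) + 1)
  · exact hp hu
  rw [Metric.mem_closedBall, dist_eq_norm, not_le] at hu
  refine hp0.trans (le_trans ?_ (add_le_add_right (hlow u (by linarith)) _))
  simp only [Ψ, h₀, ← EReal.coe_add, EReal.coe_le_coe_iff, ← ha]
  have h1 : ‖u - x₀‖ - a ≤ ‖u - x‖ := by
    have := norm_sub_le (u - x) (x₀ - x)
    rw [sub_sub_sub_cancel_right] at this
    linarith
  nlinarith [mul_nonneg (norm_nonneg (u - x₀)) (sub_nonneg.2 hu.le), pow_le_pow_left₀ (by linarith) h1 2]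

lemma hasGradientAt_half_sq_dist (x p : Vec n) :
    HasGradientAt (fun u : Vec n => 1 / 2 * ‖u - x‖ ^ 2) (p - x) p := by
  rw [hasGradientAt_iff_hasFDerivAt]
  have := (((hasFDerivAt_id p).sub_const x).norm_sq).const_mul (1 / 2 : ℝ)
  refine this.congr_fderiv ?_
  ext v
  simp

lemma IsProx.isSubgrad (hφ : IsGammaZero φ) {x p : Vec n} (h : IsProx φ x p) :
    IsSubgrad φ p (x - p) := by
  rw [← neg_sub p x]
  exact IsMinimizer.isSubgrad hφ (hasGradientAt_half_sq_dist x p) h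

lemma IsGammaZero.isSubgrad_prox (hφ : IsGammaZero φ) (x : Vec n) :
    IsSubgrad φ (prox φ x) (x - prox φ x) :=
  IsProx.isSubgrad hφ (Classical.epsilon_spec (hφ.exists_isProx x))

/-- The quadratic term leaves a gap `‖u - p‖ ^ 2 / 2`, which forces uniqueness. Since `φ` need not
be in `Γ₀`, this applies to a conjugate without checking that it is. -/
lemma IsSubgrad.prox_eq {x p : Vec n} (h : IsSubgrad φ p (x - p)) : prox φ x = p := by
  have hsq : ∀ u : Vec n, 1 / 2 * ‖p - x‖ ^ 2 + inner ℝ (p - x) (u - p) + 1 / 2 * ‖u - p‖ ^ 2 =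
      1 / 2 * ‖u - x‖ ^ 2 := fun u => by
    rw [← sub_add_sub_cancel u p x, norm_add_sq_real, real_inner_comm]
    ring
  have hex : IsProx φ x p :=
    IsSubgrad.isMinimizer (G := p - x) (fun u => by nlinarith [hsq u, sq_nonneg ‖u - p‖])
      (by rwa [neg_sub])
  have hq : IsProx φ x (prox φ x) := Classical.epsilon_spec ⟨p, hex⟩
  obtain ⟨r, hr, h⟩ := h
  have h1 := (add_le_add_right (h (prox φ x)) _).trans (hq.2 p)
  simp only [hr] at h1
  norm_cast at h1
  have h2 := hsq (prox φ x)
  rw [← neg_sub p x, inner_neg_left] at h1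
  have h3 : ‖prox φ x - p‖ ^ 2 ≤ 0 := by linarith
  exact sub_eq_zero.1 (norm_eq_zero.1 (pow_eq_zero_iff two_ne_zero |>.1 (le_antisymm h3 (sq_nonneg _))))

lemma IsGammaZero.isSubgrad_prox_scale (hφ : IsGammaZero φ) {c : ℝ} (hc : 0 < c) (x : Vec n) :
    IsSubgrad φ (prox (FixedPointOpt.scale c φ) x)
      (c⁻¹ • (x - prox (FixedPointOpt.scale c φ) x)) := by
  rw [← isSubgrad_scale_iff hc, smul_inv_smul₀ hc.ne']
  exact (hφ.scale hc).isSubgrad_prox x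

lemma IsSubgrad.prox_scale_eq {c : ℝ} (hc : 0 < c) {x p : Vec n}
    (h : IsSubgrad φ p (c⁻¹ • (x - p))) : prox (FixedPointOpt.scale c φ) x = p := by
  rw [← isSubgrad_scale_iff hc, smul_inv_smul₀ hc.ne'] at h
  exact h.prox_eq

/-- Equality in Fenchel–Young at `(p, s)`; this direction needs no convexity. -/
lemma IsSubgrad.conjugate {p s : Vec n} (h : IsSubgrad φ p s) : IsSubgrad (conjugate φ) s p := by
  obtain ⟨r, hr, h⟩ := h
  have hle : ∀ z : Vec n, ((inner ℝ z p - r : ℝ) : EReal) ≤ FixedPointOpt.conjugate φ z := fun z => by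
    refine le_iSup_of_le p ?_
    rw [hr, EReal.coe_sub]
  refine ⟨inner ℝ s p - r, le_antisymm (iSup_le fun y => ?_) (hle s), fun z => ?_⟩
  · rw [EReal.sub_le_iff_le_add
      (.inl (ne_bot_of_le_ne_bot (EReal.coe_ne_bot _) (h y))) (.inr (EReal.coe_ne_bot _))]
    refine le_trans ?_ (add_le_add_right (h y) _)
    rw [← EReal.coe_add, EReal.coe_le_coe_iff, inner_sub_right]
    linarith
  · refine le_trans (EReal.coe_le_coe_iff.2 ?_) (hle z)
    rw [inner_sub_right, real_inner_comm s p, real_inner_comm z p]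
    linarith

/-- Moreau's decomposition. -/
lemma IsGammaZero.prox_scale_conjugate (hφ : IsGammaZero φ) {c : ℝ} (hc : 0 < c) (x : Vec n) :
    prox (FixedPointOpt.scale c (FixedPointOpt.conjugate φ)) (c • x) =
      c • (x - prox (FixedPointOpt.scale (1 / c) φ) x) := by
  -- With `p` the proximal point of `φ / c` at `x`, `c • (x - p)` is a subgradient at `p`; inverting
  -- this puts `p` in the subdifferential of the conjugate.
  have h := hφ.isSubgrad_prox_scale (one_div_pos.2 hc) x
  rw [one_div, inv_inv] at h
  refine IsSubgrad.prox_scale_eq hc ?_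
  rw [← smul_sub, sub_sub_cancel, inv_smul_smul₀ hc.ne', one_div]
  exact h.conjugate

/-- Reading Moreau's decomposition backwards returns a subgradient of `φ` itself, with no
biconjugation theorem. -/
lemma IsGammaZero.isSubgrad_prox_conjugate (hφ : IsGammaZero φ) {c : ℝ} (hc : 0 < c) (w : Vec n) :
    IsSubgrad φ (c⁻¹ • (w - prox (FixedPointOpt.scale c (FixedPointOpt.conjugate φ)) w))
      (prox (FixedPointOpt.scale c (FixedPointOpt.conjugate φ)) w) := by
  obtain ⟨x, rfl⟩ : ∃ x, w = c • x := ⟨c⁻¹ • w, (smul_inv_smul₀ hc.ne' w).symm⟩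
  have h := hφ.isSubgrad_prox_scale (one_div_pos.2 hc) x
  rw [hφ.prox_scale_conjugate hc, ← smul_sub, sub_sub_cancel, inv_smul_smul₀ hc.ne']
  rwa [one_div, inv_inv, ← one_div] at h

end Prox

/-! ### The averagedness estimate; gradient and proximal gradient methods. -/

section ForwardBackward

/-- The scalar estimate behind averagedness of forward-backward operators: `D`, `E`, `R` are the
squared lengths of `d`, `e` and `r = d - e`, and `S` is the inner product of `r` and `e`. -/
lemma add_mul_le_of_cocoercive {V : Type*} [NormedAddCommGroup V] [InnerProductSpace ℝ V]
    {g d e : V} {L c D E R S : ℝ} (hL : 0 < L) (hc : L / 2 < c) (hD : D = E + R + 2 * S)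
    (hS : inner ℝ g e ≤ S) (hg : ‖g‖ ^ 2 ≤ L * inner ℝ g d) (hR : c * ‖d - e‖ ^ 2 ≤ R) :
    E + (1 - L / (2 * c)) * R ≤ D := by
  have hc0 : 0 < c := by linarith
  have h1 : inner ℝ g e = inner ℝ g d - inner ℝ g (d - e) := by rw [inner_sub_right]; ring
  have h2 := real_inner_le_norm g (d - e)
  have h3 : ‖g‖ ^ 2 / L ≤ inner ℝ g d := by rwa [div_le_iff₀' hL]
  -- Young's inequality, weighted so that the `‖g‖ ^ 2` term is exactly absorbed by cocoercivity.
  have h4 : 2 * (‖g‖ * ‖d - e‖) ≤ 2 * (‖g‖ ^ 2 / L) + L / 2 * ‖d - e‖ ^ 2 := by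
    have : 2 * (‖g‖ ^ 2 / L) + L / 2 * ‖d - e‖ ^ 2 - 2 * (‖g‖ * ‖d - e‖) =
        2 / L * (‖g‖ - L / 2 * ‖d - e‖) ^ 2 := by field_simp; ring
    have : 0 ≤ 2 / L * (‖g‖ - L / 2 * ‖d - e‖) ^ 2 := by positivity
    linarith
  have h5 : L / 2 * ‖d - e‖ ^ 2 ≤ L / (2 * c) * R := by
    calc L / 2 * ‖d - e‖ ^ 2 = L / (2 * c) * (c * ‖d - e‖ ^ 2) := by field_simp
      _ ≤ _ := by gcongr
  linarith

variable {n : ℕ} {f : Vec n → ℝ} {g : Vec n → EReal} {L β : ℝ}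

lemma isGAN_T₂ (hf : ConvexOn ℝ Set.univ f) (hd : Differentiable ℝ f) (hL : 0 < L)
    (hlip : ∀ x y, ‖gradient f x - gradient f y‖ ≤ L * ‖x - y‖) (hβ : 0 < β) (hβL : β < 2 / L)
    (hg : IsGammaZero g) : IsGAN (fun x : Vec n => ‖x‖) 2 (T₂ f g β) := by
  have hc : L / 2 < β⁻¹ := by
    rw [lt_div_iff₀ hL] at hβL
    rw [lt_inv_comm₀ (by positivity) hβ, inv_div, lt_div_iff₀ hL]
    exact hβL
  refine ⟨1 - L / (2 * β⁻¹), sub_pos.2 ((div_lt_one (by positivity)).2 (by linarith)),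
    fun x y => ?_⟩
  simp only [Real.rpow_two]
  have hx := hg.isSubgrad_prox_scale hβ (T₁ f β x)
  have hy := hg.isSubgrad_prox_scale hβ (T₁ f β y)
  have hm := hx.inner_nonneg hy
  change 0 ≤ inner ℝ (β⁻¹ • (T₁ f β x - T₂ f g β x) - β⁻¹ • (T₁ f β y - T₂ f g β y))
    (T₂ f g β x - T₂ f g β y) at hm
  have hgr := hf.norm_gradient_sub_sq_le hd hL hlip x y
  set p := T₂ f g β x
  set q := T₂ f g β y
  have e1 : β⁻¹ • (T₁ f β x - p) - β⁻¹ • (T₁ f β y - q) =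
      β⁻¹ • ((x - y) - (p - q)) - (gradient f x - gradient f y) := by
    simp only [T₁, smul_sub, inv_smul_smul₀ hβ.ne']
    abel
  have e2 : (x - p) - (y - q) = (x - y) - (p - q) := by abel
  rw [e1, inner_sub_left, inner_smul_left, RCLike.conj_to_real, sub_nonneg] at hm
  rw [e2]
  have e3 : ‖x - y‖ ^ 2 = ‖p - q‖ ^ 2 + ‖(x - y) - (p - q)‖ ^ 2 +
      2 * inner ℝ ((x - y) - (p - q)) (p - q) := by
    nth_rw 1 [← sub_add_cancel (x - y) (p - q)]
    rw [norm_add_sq_real]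
    ring
  -- Squared norms are scaled by `β⁻¹`, so that `c = β⁻¹` and `S` matches the monotonicity
  -- inequality.
  have := add_mul_le_of_cocoercive (D := β⁻¹ * ‖x - y‖ ^ 2) (E := β⁻¹ * ‖p - q‖ ^ 2) hL hc
    (by rw [e3]; ring) hm hgr le_rfl
  rw [mul_left_comm, ← mul_add] at this
  exact le_of_mul_le_mul_left this (inv_pos.2 hβ)

/-- Both sides say that `-∇f z` is a subgradient of `g` at `z`. -/
lemma T₂_eq_self_iff (hf : ConvexOn ℝ Set.univ f) (hd : Differentiable ℝ f) (hβ : 0 < β)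
    (hg : IsGammaZero g) {z : Vec n} :
    T₂ f g β z = z ↔ IsMinimizer (fun x => (f x : EReal) + g x) z := by
  have e : β⁻¹ • (T₁ f β z - z) = -gradient f z := by
    rw [T₁, sub_sub_cancel_left, smul_neg, inv_smul_smul₀ hβ.ne']
  constructor
  · intro h
    have h1 := hg.isSubgrad_prox_scale hβ (T₁ f β z)
    change IsSubgrad g (T₂ f g β z) (β⁻¹ • (T₁ f β z - T₂ f g β z)) at h1
    rw [h, e] at h1
    exact h1.isMinimizer fun u => hf.add_inner_gradient_le hd z u
  · intro h
    refine IsSubgrad.prox_scale_eq hβ ?_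
    rw [e]
    exact h.isSubgrad hg (hd z).hasGradientAt

lemma convergesWithRate_T₂ (hf : ConvexOn ℝ Set.univ f) (hd : Differentiable ℝ f) (hL : 0 < L)
    (hlip : ∀ x y, ‖gradient f x - gradient f y‖ ≤ L * ‖x - y‖) (hβ : 0 < β) (hβL : β < 2 / L)
    (hg : IsGammaZero g) (hmin : ∃ z, IsMinimizer (fun x => (f x : EReal) + g x) z)
    {x : ℕ → Vec n} (hx : ∀ k, x (k + 1) = T₂ f g β (x k)) :
    ConvergesWithRate (fun x => (f x : EReal) + g x) x := by
  obtain ⟨z, hz⟩ := hmin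
  obtain ⟨⟨q, hq, hlim⟩, hrate⟩ :=
    (isGAN_T₂ hf hd hL hlip hβ hβL hg).tendsto_fixedPoint (c := 1) (C := 1) one_pos
      (fun v => (one_mul _).le) (fun v => (one_mul _).ge) hx ⟨z, (T₂_eq_self_iff hf hd hβ hg).2 hz⟩
  exact ⟨⟨q, (T₂_eq_self_iff hf hd hβ hg).1 hq, hlim⟩, hrate⟩

lemma T₂_zero (hβ : 0 < β) : T₂ f (fun _ => 0) β = T₁ f β := by
  funext x
  refine IsSubgrad.prox_scale_eq hβ ?_
  rw [sub_self, smul_zero]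
  exact ⟨0, rfl, fun u => by simp⟩

end ForwardBackward

/-! ### Block matrices and stacked vectors. -/

section Block

variable {n m : ℕ}

lemma app_add {ι κ : Type*} [Fintype κ] (M : Matrix ι κ ℝ) (v w : EuclideanSpace ℝ κ) :
    app M (v + w) = app M v + app M w := by
  ext; simp [app, Matrix.mulVec_add]

lemma app_sub {ι κ : Type*} [Fintype κ] (M : Matrix ι κ ℝ) (v w : EuclideanSpace ℝ κ) :
    app M (v - w) = app M v - app M w := by
  ext; simp [app, Matrix.mulVec_sub]

lemma app_smul {ι κ : Type*} [Fintype κ] (M : Matrix ι κ ℝ) (c : ℝ) (v : EuclideanSpace ℝ κ) :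
    app M (c • v) = c • app M v := by
  ext; simp [app, Matrix.mulVec_smul]

lemma smul_app {ι κ : Type*} [Fintype κ] (M : Matrix ι κ ℝ) (c : ℝ) (v : EuclideanSpace ℝ κ) :
    app (c • M) v = c • app M v := by
  ext; simp [app, Matrix.smul_mulVec]

lemma app_app {ι κ : Type*} [Fintype ι] [Fintype κ] {l : Type*} (M : Matrix l ι ℝ)
    (N : Matrix ι κ ℝ) (v : EuclideanSpace ℝ κ) : app M (app N v) = app (M * N) v := by
  ext; simp [app, Matrix.mulVec_mulVec]

lemma norm_app_le (B : Matrix (Fin m) (Fin n) ℝ) (x : Vec n) : ‖app B x‖ ≤ ‖B‖ * ‖x‖ :=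
  Matrix.l2_opNorm_mulVec B x

lemma inner_app (B : Matrix (Fin m) (Fin n) ℝ) (x : Vec n) (y : Vec m) :
    inner ℝ (app Bᵀ y) x = inner ℝ (app B x) y := by
  simp only [EuclideanSpace.inner_eq_star_dotProduct, app, star_trivial]
  rw [Matrix.mulVec_transpose, dotProduct_comm, ← Matrix.dotProduct_mulVec]

lemma primal_stack (x : Vec n) (y : Vec m) : primal (stack x y) = x := rfl
lemma dual_stack (x : Vec n) (y : Vec m) : dual (stack x y) = y := rfl
lemma primal_add (v w : Stack n m) : primal (v + w) = primal v + primal w := rfl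
lemma primal_sub (v w : Stack n m) : primal (v - w) = primal v - primal w := rfl
lemma dual_sub (v w : Stack n m) : dual (v - w) = dual v - dual w := rfl

lemma inner_stack (v w : Stack n m) :
    inner ℝ v w = inner ℝ (primal v) (primal w) + inner ℝ (dual v) (dual w) := by
  simp [PiLp.inner_apply, primal, dual]

lemma norm_sq_stack (v : Stack n m) : ‖v‖ ^ 2 = ‖primal v‖ ^ 2 + ‖dual v‖ ^ 2 := by
  simp only [← real_inner_self_eq_norm_sq, inner_stack]

lemma norm_primal_le (v : Stack n m) : ‖primal v‖ ≤ ‖v‖ :=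
  (sq_le_sq₀ (norm_nonneg _) (norm_nonneg _)).1 (by nlinarith [norm_sq_stack v, sq_nonneg ‖dual v‖])

lemma norm_dual_le (v : Stack n m) : ‖dual v‖ ≤ ‖v‖ :=
  (sq_le_sq₀ (norm_nonneg _) (norm_nonneg _)).1
    (by nlinarith [norm_sq_stack v, sq_nonneg ‖primal v‖])

/-- The primal block as a continuous linear map. -/
noncomputable def primalCLM (n m : ℕ) : Stack n m →L[ℝ] Vec n :=
  LinearMap.mkContinuous ⟨⟨primal, primal_add⟩, fun _ _ => rfl⟩ 1 fun v => by
    rw [one_mul]; exact norm_primal_le v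

lemma app_fromBlocks (A : Matrix (Fin n) (Fin n) ℝ) (B : Matrix (Fin n) (Fin m) ℝ)
    (C : Matrix (Fin m) (Fin n) ℝ) (D : Matrix (Fin m) (Fin m) ℝ) (v : Stack n m) :
    app (Matrix.fromBlocks A B C D) v =
      stack (app A (primal v) + app B (dual v)) (app C (primal v) + app D (dual v)) := by
  ext i
  simp only [app, stack, Matrix.fromBlocks_mulVec]
  rcases i with i | i <;> rfl

lemma app_one {k : ℕ} (x : Vec k) : app (1 : Matrix (Fin k) (Fin k) ℝ) x = x := by
  ext; simp [app]

lemma app_neg {ι κ : Type*} [Fintype κ] (M : Matrix ι κ ℝ) (v : EuclideanSpace ℝ κ) :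
    app (-M) v = -app M v := by
  ext; simp [app, Matrix.neg_mulVec]

lemma app_zero_left {ι κ : Type*} [Fintype κ] (v : EuclideanSpace ℝ κ) :
    app (0 : Matrix ι κ ℝ) v = 0 := by
  ext; simp [app]

lemma dotProduct_matW_mulVec (B : Matrix (Fin m) (Fin n) ℝ) (β η : ℝ) (v : Stack n m) :
    v.ofLp ⬝ᵥ (matW B β η *ᵥ v.ofLp) =
      β⁻¹ * ‖primal v‖ ^ 2 - 2 * inner ℝ (app B (primal v)) (dual v) + η⁻¹ * ‖dual v‖ ^ 2 := by
  have h : v.ofLp ⬝ᵥ (matW B β η *ᵥ v.ofLp) = inner ℝ (app (matW B β η) v) v := by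
    simp [EuclideanSpace.inner_eq_star_dotProduct, app]
  rw [h, matW, app_fromBlocks, inner_stack]
  simp only [primal_stack, dual_stack, smul_app, app_one, app_neg, inner_add_left, inner_neg_left,
    inner_app, inner_smul_left, real_inner_self_eq_norm_sq, RCLike.conj_to_real, one_div]
  ring

lemma hasGradientAt_comp_primal {f : Vec n → ℝ} (hd : Differentiable ℝ f) (v : Stack n m) :
    HasGradientAt (fun w : Stack n m => f (primal w)) (stack (gradient f (primal v)) 0) v := by
  rw [hasGradientAt_iff_hasFDerivAt]
  have h := (hd (primalCLM n m v)).hasGradientAt.hasFDerivAt.comp v (primalCLM n m).hasFDerivAt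
  refine h.congr_fderiv ?_
  ext w
  simp [inner_stack, primal_stack, dual_stack, primalCLM]
  rfl

end Block

/-! ### The primal-dual method as forward-backward iteration in the metric `W`. -/

section PrimalDual

variable {n m : ℕ} {B : Matrix (Fin m) (Fin n) ℝ} {f : Vec n → ℝ} {g : Vec m → EReal}
  {h : Vec n → EReal} {L β η : ℝ}

/-- After clearing denominators, the positive term `η * (L * (2 - β * L))` is dropped; what remains
is `β * (L / 2 + η * ‖B‖ ^ 2) < 1`. -/
lemma half_lt_of_stepsize (hL : 0 < L) (hβ : 0 < β) (hβL : β < 2 / L) (hη : 0 < η)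
    (hη' : η < 2 * (2 - β * L) / (4 * β * ‖B‖ ^ 2 + L * (2 - β * L))) :
    L / 2 < β⁻¹ - η * ‖B‖ ^ 2 := by
  rw [lt_div_iff₀ hL] at hβL
  have h1 : 0 < L * (2 - β * L) := mul_pos hL (by linarith)
  rw [lt_div_iff₀ (by positivity)] at hη'
  have h2 : 0 < η * (L * (2 - β * L)) := mul_pos hη h1
  have h3 : β * (L / 2 + η * ‖B‖ ^ 2) < 1 := by linarith
  have h4 := (lt_inv_mul_iff₀ hβ).2 h3
  linarith

/-- Completing the square in the dual norm: a Schur complement bound. It supplies the constant `c`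
of the averagedness estimate. -/
lemma mul_norm_primal_sq_le (hη : 0 < η) (v : Stack n m) :
    (β⁻¹ - η * ‖B‖ ^ 2) * ‖primal v‖ ^ 2 ≤ v.ofLp ⬝ᵥ (matW B β η *ᵥ v.ofLp) := by
  rw [dotProduct_matW_mulVec]
  have h1 : inner ℝ (app B (primal v)) (dual v) ≤ ‖B‖ * ‖primal v‖ * ‖dual v‖ :=
    (real_inner_le_norm _ _).trans
      (mul_le_mul_of_nonneg_right (norm_app_le B _) (norm_nonneg _))
  have h2 : 0 ≤ η⁻¹ * (‖dual v‖ - η * (‖B‖ * ‖primal v‖)) ^ 2 := by positivity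
  have h3 : η⁻¹ * (‖dual v‖ - η * (‖B‖ * ‖primal v‖)) ^ 2 = η⁻¹ * ‖dual v‖ ^ 2 -
      2 * (‖B‖ * ‖primal v‖ * ‖dual v‖) + η * ‖B‖ ^ 2 * ‖primal v‖ ^ 2 := by
    field_simp
    ring
  linarith

lemma mul_norm_dual_sq_le (hβ : 0 < β) (v : Stack n m) :
    (η⁻¹ - β * ‖B‖ ^ 2) * ‖dual v‖ ^ 2 ≤ v.ofLp ⬝ᵥ (matW B β η *ᵥ v.ofLp) := by
  rw [dotProduct_matW_mulVec]
  have h1 : inner ℝ (app B (primal v)) (dual v) ≤ ‖B‖ * ‖primal v‖ * ‖dual v‖ :=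
    (real_inner_le_norm _ _).trans
      (mul_le_mul_of_nonneg_right (norm_app_le B _) (norm_nonneg _))
  have h2 : 0 ≤ β⁻¹ * (‖primal v‖ - β * (‖B‖ * ‖dual v‖)) ^ 2 := by positivity
  have h3 : β⁻¹ * (‖primal v‖ - β * (‖B‖ * ‖dual v‖)) ^ 2 = β⁻¹ * ‖primal v‖ ^ 2 -
      2 * (‖B‖ * ‖primal v‖ * ‖dual v‖) + β * ‖B‖ ^ 2 * ‖dual v‖ ^ 2 := by
    field_simp
    ring
  linarith

lemma exists_mul_norm_sq_le (hβ : 0 < β) (hη : 0 < η) (hc : 0 < β⁻¹ - η * ‖B‖ ^ 2) :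
    ∃ c, 0 < c ∧ ∀ v : Stack n m, c * ‖v‖ ^ 2 ≤ v.ofLp ⬝ᵥ (matW B β η *ᵥ v.ofLp) := by
  -- Both margins have the sign of `1 - β * η * ‖B‖ ^ 2`.
  have hc' : 0 < η⁻¹ - β * ‖B‖ ^ 2 := by
    have h1 : β * (β⁻¹ - η * ‖B‖ ^ 2) = η * (η⁻¹ - β * ‖B‖ ^ 2) := by field_simp
    exact (mul_pos_iff_of_pos_left hη).1 (h1 ▸ mul_pos hβ hc)
  refine ⟨min (β⁻¹ - η * ‖B‖ ^ 2) (η⁻¹ - β * ‖B‖ ^ 2) / 2, by positivity, fun v => ?_⟩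
  have h1 := mul_norm_primal_sq_le (B := B) (β := β) hη v
  have h2 := mul_norm_dual_sq_le (B := B) (η := η) hβ v
  have h3 := mul_le_mul_of_nonneg_right
    (min_le_left (β⁻¹ - η * ‖B‖ ^ 2) (η⁻¹ - β * ‖B‖ ^ 2)) (sq_nonneg ‖primal v‖)
  have h4 := mul_le_mul_of_nonneg_right
    (min_le_right (β⁻¹ - η * ‖B‖ ^ 2) (η⁻¹ - β * ‖B‖ ^ 2)) (sq_nonneg ‖dual v‖)
  rw [norm_sq_stack]
  linarith

lemma posDef_matW (hβ : 0 < β) (hη : 0 < η) (hc : 0 < β⁻¹ - η * ‖B‖ ^ 2) :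
    (matW B β η).PosDef := by
  obtain ⟨c, hc0, hlow⟩ := exists_mul_norm_sq_le hβ hη hc
  refine Matrix.PosDef.of_dotProduct_mulVec_pos ?_ fun x hx => ?_
  · simp [Matrix.IsHermitian, matW, Matrix.fromBlocks_transpose]
  · rw [star_trivial]
    refine lt_of_lt_of_le ?_ (hlow (WithLp.toLp 2 x))
    have : WithLp.toLp 2 x ≠ (0 : Stack n m) := by simpa using hx
    positivity

lemma weightedNorm_sq (hη : 0 < η) (hc : 0 < β⁻¹ - η * ‖B‖ ^ 2) (v : Stack n m) :
    weightedNorm (matW B β η) v ^ 2 =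
      β⁻¹ * ‖primal v‖ ^ 2 - 2 * inner ℝ (app B (primal v)) (dual v) + η⁻¹ * ‖dual v‖ ^ 2 := by
  rw [weightedNorm, Real.sq_sqrt, dotProduct_matW_mulVec]
  exact (mul_nonneg hc.le (sq_nonneg _)).trans (mul_norm_primal_sq_le hη v)

lemma exists_norm_le_weightedNorm (hβ : 0 < β) (hη : 0 < η) (hc : 0 < β⁻¹ - η * ‖B‖ ^ 2) :
    ∃ c, 0 < c ∧ ∀ v : Stack n m, c * ‖v‖ ≤ weightedNorm (matW B β η) v := by
  obtain ⟨c, hc0, hlow⟩ := exists_mul_norm_sq_le hβ hη hc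
  refine ⟨√c, Real.sqrt_pos.2 hc0, fun v => Real.le_sqrt_of_sq_le ?_⟩
  rw [mul_pow, Real.sq_sqrt hc0.le]
  exact hlow v

lemma exists_weightedNorm_le (hβ : 0 < β) (hη : 0 < η) :
    ∃ C, ∀ v : Stack n m, weightedNorm (matW B β η) v ≤ C * ‖v‖ := by
  refine ⟨√(β⁻¹ + 2 * ‖B‖ + η⁻¹), fun v => Real.sqrt_le_iff.2 ⟨by positivity, ?_⟩⟩
  rw [mul_pow, Real.sq_sqrt (by positivity), dotProduct_matW_mulVec]
  have h1 : -inner ℝ (app B (primal v)) (dual v) ≤ ‖B‖ * ‖v‖ * ‖v‖ :=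
    (neg_le_abs _).trans <| (abs_real_inner_le_norm _ _).trans <|
      mul_le_mul ((norm_app_le B _).trans (by gcongr; exact norm_primal_le v)) (norm_dual_le v)
        (norm_nonneg _) (by positivity)
  have h2 : β⁻¹ * ‖primal v‖ ^ 2 ≤ β⁻¹ * ‖v‖ ^ 2 := by gcongr; exact norm_primal_le v
  have h3 : η⁻¹ * ‖dual v‖ ^ 2 ≤ η⁻¹ * ‖v‖ ^ 2 := by gcongr; exact norm_dual_le v
  linarith

/-- `E - G` has only a lower-left block, so the implicit equation is solved in order: primal block,
then dual. -/
lemma TG_eq (u : Stack n m) :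
    TG g h B β η u = stack (prox (scale β h) (primal (app (matG B β η) u)))
      (prox (scale η (conjugate g)) (app ((2 * η) • B)
        (prox (scale β h) (primal (app (matG B β η) u))) + dual (app (matG B β η) u))) := by
  have hv : RelTG g h B β η u (TG g h B β η u) := (existsUnique_relTG g h B β η u).choose_spec.1
  generalize TG g h B β η u = v at hv ⊢
  simp only [RelTG, blockProx, primal_app_sub, dual_app_sub] at hv
  have hp : primal v = prox (scale β h) (primal (app (matG B β η) u)) := by
    rw [hv, primal_stack]
  rwa [hp] at hv

/-- `G` is `W` with its block rows scaled by `β` and `η`, so preconditioning by `W⁻¹` becomes an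
explicit gradient step. -/
lemma matG_mul_inv (hβ : 0 < β) (hη : 0 < η) (hW : (matW B β η).PosDef) :
    matG B β η * (matW B β η)⁻¹ = Matrix.fromBlocks (β • 1) 0 0 (η • 1) := by
  have h1 : matG B β η = Matrix.fromBlocks (β • 1) 0 0 (η • 1) * matW B β η := by
    simp [matG, matW, Matrix.fromBlocks_multiply, hβ.ne', hη.ne']
  rw [h1, mul_assoc, Matrix.mul_nonsing_inv _ ((Matrix.isUnit_iff_isUnit_det _).1 hW.isUnit),
    mul_one]

/-- The dual step of the primal-dual algorithm, given the new and the old primal points. -/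
noncomputable def dualStep (g : Vec m → EReal) (B : Matrix (Fin m) (Fin n) ℝ) (η : ℝ)
    (p x : Vec n) (y : Vec m) : Vec m :=
  prox (scale η (conjugate g)) (y + η • app B ((2 : ℝ) • p - x))

/-- The primal step of the primal-dual algorithm. -/
noncomputable def primalStep (f : Vec n → ℝ) (h : Vec n → EReal) (B : Matrix (Fin m) (Fin n) ℝ)
    (β : ℝ) (x : Vec n) (y : Vec m) : Vec n :=
  prox (scale β h) (x - β • (gradient f x + app Bᵀ y))

lemma T₃_eq (hd : Differentiable ℝ f) (hβ : 0 < β) (hη : 0 < η) (hW : (matW B β η).PosDef)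
    (v : Stack n m) :
    T₃ f g h B β η v = stack (primalStep f h B β (primal v) (dual v))
      (dualStep g B η (primalStep f h B β (primal v) (dual v)) (primal v) (dual v)) := by
  rw [T₃, (hasGradientAt_comp_primal hd v).gradient, TG_eq, app_sub, app_app,
    matG_mul_inv hβ hη hW, matG, app_fromBlocks, app_fromBlocks]
  simp only [primal_sub, dual_sub, primal_stack, dual_stack, smul_app, app_one, app_neg,
    app_zero_left]
  have e1 : primal v + -(β • app Bᵀ (dual v)) - (β • gradient f (primal v) + 0) =
      primal v - β • (gradient f (primal v) + app Bᵀ (dual v)) := by module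
  rw [e1]
  change stack (primalStep f h B β (primal v) (dual v)) (prox (scale η (conjugate g))
    ((2 * η) • app B (primalStep f h B β (primal v) (dual v)) + _)) = _
  -- The term `2 * η` from `E - G` and `-η` from `G` combine into the extrapolation `2 • p - x`.
  rw [dualStep, app_sub, app_smul]
  congr 2
  module

lemma isSubgrad_primalStep (hh : IsGammaZero h) (hβ : 0 < β) (x : Vec n) (y : Vec m) :
    IsSubgrad h (primalStep f h B β x y)
      (β⁻¹ • (x - primalStep f h B β x y) - gradient f x - app Bᵀ y) := by
  have key := hh.isSubgrad_prox_scale hβ (x - β • (gradient f x + app Bᵀ y))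
  change IsSubgrad h (primalStep f h B β x y)
    (β⁻¹ • (x - β • (gradient f x + app Bᵀ y) - primalStep f h B β x y)) at key
  rwa [sub_right_comm, smul_sub, inv_smul_smul₀ hβ.ne', ← sub_sub] at key

lemma isSubgrad_dualStep (hg : IsGammaZero g) (hη : 0 < η) (p x : Vec n) (y : Vec m) :
    IsSubgrad g (η⁻¹ • (y - dualStep g B η p x y) + app B ((2 : ℝ) • p - x))
      (dualStep g B η p x y) := by
  have key := hg.isSubgrad_prox_conjugate hη (y + η • app B ((2 : ℝ) • p - x))
  rwa [← dualStep, add_sub_right_comm, smul_add, inv_smul_smul₀ hη.ne'] at key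

lemma isGAN_T₃ (hf : ConvexOn ℝ Set.univ f) (hd : Differentiable ℝ f) (hL : 0 < L)
    (hlip : ∀ x y, ‖gradient f x - gradient f y‖ ≤ L * ‖x - y‖) (hβ : 0 < β) (hη : 0 < η)
    (hc : L / 2 < β⁻¹ - η * ‖B‖ ^ 2) (hg : IsGammaZero g) (hh : IsGammaZero h) :
    IsGAN (weightedNorm (matW B β η)) 2 (T₃ f g h B β η) := by
  have hc0 : 0 < β⁻¹ - η * ‖B‖ ^ 2 := by linarith
  have hW := posDef_matW hβ hη hc0
  refine ⟨1 - L / (2 * (β⁻¹ - η * ‖B‖ ^ 2)),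
    sub_pos.2 ((div_lt_one (by positivity)).2 (by linarith)), fun v w => ?_⟩
  simp only [Real.rpow_two]
  set x := primal v with hx
  set y := dual v with hy
  set x' := primal w with hx'
  set y' := dual w with hy'
  have hP1 := isSubgrad_primalStep (f := f) (B := B) hh hβ x y
  have hP2 := isSubgrad_primalStep (f := f) (B := B) hh hβ x' y'
  have hD1 := isSubgrad_dualStep (B := B) hg hη (primalStep f h B β x y) x y
  have hD2 := isSubgrad_dualStep (B := B) hg hη (primalStep f h B β x' y') x' y'
  rw [T₃_eq hd hβ hη hW, T₃_eq hd hβ hη hW, ← hx, ← hy, ← hx', ← hy']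
  generalize dualStep g B η (primalStep f h B β x y) x y = q at *
  generalize dualStep g B η (primalStep f h B β x' y') x' y' = q' at *
  generalize primalStep f h B β x y = p at *
  generalize primalStep f h B β x' y' = p' at *
  have hP := hP1.inner_nonneg hP2
  have hD := hD1.inner_nonneg hD2
  have hgr := hf.norm_gradient_sub_sq_le hd hL hlip x x'
  set G := gradient f x - gradient f x' with hG
  have eR : (v - stack p q) - (w - stack p' q') = (v - w) - (stack p q - stack p' q') := by abel
  rw [eR]
  set e := stack p q - stack p' q' with he
  have e1 : primal e = p - p' := rfl
  have e2 : dual e = q - q' := rfl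
  have d1 : primal (v - w) = x - x' := rfl
  have d2 : dual (v - w) = y - y' := rfl
  set d := v - w with hd'
  set r := d - e with hr
  have r1 : primal r = primal d - primal e := rfl
  have r2 : dual r = dual d - dual e := rfl
  have hP' : inner ℝ G (primal e) ≤ β⁻¹ * inner ℝ (primal r) (primal e) -
      inner ℝ (app B (primal e)) (dual d) := by
    have e3 : (β⁻¹ • (x - p) - gradient f x - app Bᵀ y) -
        (β⁻¹ • (x' - p') - gradient f x' - app Bᵀ y') =
        β⁻¹ • primal r - G - app Bᵀ (dual d) := by
      rw [r1, e1, d1, d2, app_sub, hG]; module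
    rw [e3, ← e1, inner_sub_left, inner_sub_left, inner_smul_left, inner_app,
      RCLike.conj_to_real] at hP
    linarith
  have hD' : 0 ≤ η⁻¹ * inner ℝ (dual r) (dual e) + inner ℝ (app B (primal e)) (dual e) -
      inner ℝ (app B (primal r)) (dual e) := by
    have e3 : (η⁻¹ • (y - q) + app B ((2 : ℝ) • p - x)) -
        (η⁻¹ • (y' - q') + app B ((2 : ℝ) • p' - x')) =
        η⁻¹ • dual r + app B (primal e) - app B (primal r) := by
      rw [r1, r2, e1, e2, d1, d2]
      simp only [app_sub, app_smul]
      module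
    rw [e3, ← e2, real_inner_comm, inner_sub_left, inner_add_left, inner_smul_left,
      RCLike.conj_to_real] at hD
    linarith
  -- `S` is the `W`-inner product of `r` and `e`. Adding `hP'` and `hD'` produces it: their coupling
  -- terms merge because `dual d - dual e = dual r`.
  refine add_mul_le_of_cocoercive (g := G) (d := primal d) (e := primal e)
    (S := β⁻¹ * inner ℝ (primal r) (primal e) - inner ℝ (app B (primal r)) (dual e) -
      inner ℝ (app B (primal e)) (dual r) + η⁻¹ * inner ℝ (dual r) (dual e)) hL hc ?_ ?_ ?_ ?_
  · rw [weightedNorm_sq hη hc0, weightedNorm_sq hη hc0, weightedNorm_sq hη hc0]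
    have p1 : primal d = primal r + primal e := by rw [r1, sub_add_cancel]
    have p2 : dual d = dual r + dual e := by rw [r2, sub_add_cancel]
    rw [p1, p2, norm_add_sq_real, norm_add_sq_real, app_add]
    simp only [inner_add_left, inner_add_right]
    ring
  · have h3 := inner_sub_right (𝕜 := ℝ) (app B (primal e)) (dual d) (dual e)
    rw [← r2] at h3
    linarith
  · rwa [d1]
  · rw [weightedNorm, Real.sq_sqrt]
    · exact mul_norm_primal_sq_le hη r
    · exact (mul_nonneg hc0.le (sq_nonneg _)).trans (mul_norm_primal_sq_le hη r)

lemma IsSubgrad.comp_app_add {x G : Vec n} {y : Vec m} (hg : IsSubgrad g (app B x) y)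
    (hh : IsSubgrad h x (-G - app Bᵀ y)) : IsSubgrad (fun u => g (app B u) + h u) x (-G) := by
  obtain ⟨a, ha, hg⟩ := hg
  obtain ⟨b, hb, hh⟩ := hh
  refine ⟨a + b, by simp only [ha, hb, EReal.coe_add], fun u => ?_⟩
  refine le_trans ?_ (add_le_add (hg (app B u)) (hh u))
  rw [← EReal.coe_add, EReal.coe_le_coe_iff, ← app_sub, inner_sub_left, inner_app,
    real_inner_comm y]
  linarith

/-- At a fixed point `(x, y)`, `y` is a subgradient of `g` at `B x` and `-∇f x - Bᵀ y` one of `h` at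
`x`. Only the easy half of the sum and chain rules is used, so no qualification condition enters. -/
lemma isMinimizer_of_T₃_eq_self (hf : ConvexOn ℝ Set.univ f) (hd : Differentiable ℝ f)
    (hβ : 0 < β) (hη : 0 < η) (hW : (matW B β η).PosDef) (hg : IsGammaZero g)
    (hh : IsGammaZero h) {v : Stack n m} (hv : T₃ f g h B β η v = v) :
    IsMinimizer (fun x => (f x : EReal) + g (app B x) + h x) (primal v) := by
  rw [T₃_eq hd hβ hη hW] at hv
  have hp : primalStep f h B β (primal v) (dual v) = primal v := congrArg primal hv
  have hq := congrArg dual hv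
  rw [dual_stack, hp] at hq
  have h1 := isSubgrad_primalStep (f := f) (B := B) hh hβ (primal v) (dual v)
  have h2 := isSubgrad_dualStep (B := B) hg hη (primal v) (primal v) (dual v)
  rw [hp, sub_self, smul_zero, zero_sub] at h1
  rw [hq, sub_self, smul_zero, zero_add, two_smul, add_sub_cancel_right] at h2
  simp only [add_assoc]
  exact (h2.comp_app_add h1).isMinimizer fun u => hf.add_inner_gradient_le hd _ u

lemma convergesWithRate_T₃ (hf : ConvexOn ℝ Set.univ f) (hd : Differentiable ℝ f) (hL : 0 < L)
    (hlip : ∀ x y, ‖gradient f x - gradient f y‖ ≤ L * ‖x - y‖) (hβ : 0 < β) (hη : 0 < η)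
    (hc : L / 2 < β⁻¹ - η * ‖B‖ ^ 2) (hg : IsGammaZero g) (hh : IsGammaZero h)
    (hfix : (Function.fixedPoints (T₃ f g h B β η)).Nonempty) {x : ℕ → Vec n} {y : ℕ → Vec m}
    (hx : ∀ k, x (k + 1) = primalStep f h B β (x k) (y k))
    (hy : ∀ k, y (k + 1) = dualStep g B η (x (k + 1)) (x k) (y k)) :
    ConvergesWithRate (fun x => (f x : EReal) + g (app B x) + h x) x := by
  have hc0 : 0 < β⁻¹ - η * ‖B‖ ^ 2 := by linarith
  have hW := posDef_matW hβ hη hc0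
  obtain ⟨c, hc1, hlow⟩ := exists_norm_le_weightedNorm hβ hη hc0
  obtain ⟨C, hup⟩ := exists_weightedNorm_le (B := B) hβ hη
  obtain ⟨⟨q, hq, hlim⟩, hrate⟩ :=
    (isGAN_T₃ hf hd hL hlip hβ hη hc hg hh).tendsto_fixedPoint hc1 hlow hup
      (z := fun k => stack (x k) (y k))
      (fun k => by rw [T₃_eq hd hβ hη hW, primal_stack, dual_stack, ← hx, ← hy]) hfix
  refine ⟨⟨primal q, isMinimizer_of_T₃_eq_self hf hd hβ hη hW hg hh hq,
    ((primalCLM n m).continuous.tendsto q).comp hlim⟩, ?_⟩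
  refine IsBigO.trans_isLittleO (IsBigO.of_bound 1 (Eventually.of_forall fun k => ?_)) hrate
  rw [norm_norm, norm_norm, one_mul]
  exact norm_primal_le (stack (x (k + 1)) (y (k + 1)) - stack (x k) (y k))

end PrimalDual
end FixedPointOpt

theorem mainTheorem9 (n : ℕ) (f : Vec n → ℝ) (L β : ℝ)
    (hf_convex : ConvexOn ℝ Set.univ f) (hf_diff : Differentiable ℝ f)
    (hL : 0 < L) (hf_lip : ∀ x y, ‖gradient f x - gradient f y‖ ≤ L * ‖x - y‖)
    (hβ : 0 < β) (hβL : β < 2 / L) :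
    -- gradient descent
    (IsGAN (fun x : Vec n => ‖x‖) 2 (T₁ f β) ∧
      ((∃ z, IsMinimizer (fun x => (f x : EReal)) z) →
        ∀ x : ℕ → Vec n, (∀ k, x (k + 1) = x k - β • gradient f (x k)) →
          ConvergesWithRate (fun x => (f x : EReal)) x)) ∧
    -- proximal gradient
    (∀ g : Vec n → EReal, IsGammaZero g →
      IsGAN (fun x : Vec n => ‖x‖) 2 (T₂ f g β) ∧
      ((∃ z, IsMinimizer (fun x => (f x : EReal) + g x) z) →
        ∀ x : ℕ → Vec n,
          (∀ k, x (k + 1) = prox (scale β g) (x k - β • gradient f (x k))) →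
          ConvergesWithRate (fun x => (f x : EReal) + g x) x)) ∧
    -- primal-dual fixed-point proximity algorithm
    (∀ (m : ℕ) (g : Vec m → EReal) (h : Vec n → EReal) (B : Matrix (Fin m) (Fin n) ℝ) (η : ℝ),
      IsGammaZero g → IsGammaZero h → 0 < η →
      η < 2 * (2 - β * L) / (4 * β * ‖B‖ ^ 2 + L * (2 - β * L)) →
      (matW B β η).PosDef ∧
      IsGAN (weightedNorm (matW B β η)) 2 (T₃ f g h B β η) ∧
      ((Function.fixedPoints (T₃ f g h B β η)).Nonempty →
        ∀ (x : ℕ → Vec n) (y : ℕ → Vec m),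
          (∀ k, x (k + 1) =
            prox (scale β h) (x k - β • (gradient f (x k) + app Bᵀ (y k)))) →
          (∀ k, y (k + 1) =
            η • (((1 / η) • y k + app B ((2 : ℝ) • x (k + 1) - x k)) -
              prox (scale (1 / η) g) ((1 / η) • y k + app B ((2 : ℝ) • x (k + 1) - x k)))) →
          ConvergesWithRate (fun x => (f x : EReal) + g (app B x) + h x) x)) := by
  have h0 : (fun x => (f x : EReal)) = fun x => (f x : EReal) + (fun _ => (0 : EReal)) x := by
    simp
  refine ⟨⟨?_, fun hmin x hx => ?_⟩, fun g hg => ⟨?_, fun hmin x hx => ?_⟩,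
    fun m g h B η hg hh hη hη' => ?_⟩
  · rw [← T₂_zero hβ]
    exact isGAN_T₂ hf_convex hf_diff hL hf_lip hβ hβL isGammaZero_zero
  · rw [h0] at hmin ⊢
    refine convergesWithRate_T₂ hf_convex hf_diff hL hf_lip hβ hβL isGammaZero_zero hmin fun k => ?_
    rw [T₂_zero hβ, hx, T₁]
  · exact isGAN_T₂ hf_convex hf_diff hL hf_lip hβ hβL hg
  · exact convergesWithRate_T₂ hf_convex hf_diff hL hf_lip hβ hβL hg hmin hx
  · have hc := half_lt_of_stepsize hL hβ hβL hη hη'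
    refine ⟨posDef_matW hβ hη (by linarith),
      isGAN_T₃ hf_convex hf_diff hL hf_lip hβ hη hc hg hh, fun hfix x y hx hy => ?_⟩
    refine convergesWithRate_T₃ hf_convex hf_diff hL hf_lip hβ hη hc hg hh hfix hx fun k => ?_
    -- Moreau's decomposition identifies the stated dual update with the proximal step of the
    -- conjugate.
    rw [hy, ← hg.prox_scale_conjugate hη, smul_add, one_div, smul_inv_smul₀ hη.ne', dualStep]
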